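/- Let $\mathbb{F}$ denote the Fano plane, regarded as the $3$-uniform hypergraph with $7$ vertices whose $7$ edges are the lines of the projective plane of order $2$. For a $3$-uniform hypergraph $\mathcal{G}$ on $[n]=\{1,\dots,n\}$ and a set $E\subseteq[n]$, let $d(E)$ be the number of edges of $\mathcal{G}$ containing $E$, and let \[\mathrm{co}_2(\mathcal{G})=\sum_{E\in\binom{[n]}{2}} d(E)^2 .\] Let $\mathrm{exco}_2(n,\mathbb{F})$ be the maximum of $\mathrm{co}_2(\mathcal{G})$ over all $3$-uniform hypergraphs $\mathcal{G}$ on $[n]$ that contain no (not necessarily induced) copy of $\mathbb{F}$. Then the codegree squared density \[\sigma(\mathbb{F})=\lim_{n\to\infty}\frac{\mathrm{exco}_2(n,\mathbb{F})}{\binom{n}{2}(n-2)^2}\] exists and satisfies \[\sigma(\mathbb{F})\le\frac{11}{16}.\] -/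

import Mathlib

namespace CodegreeSquared

/-- The codegree `d(E)` of a vertex set `E`: the number of edges of `G` containing `E`. -/
def codegree {V : Type*} [DecidableEq V] (G : Finset (Finset V)) (E : Finset V) : ℕ :=
  (G.filter fun e => E ⊆ e).card

/-- The codegree squared sum `co₂(G) = ∑ d(E)²` of a `k`-uniform hypergraph `G` on `V`,
the sum being over all `(k-1)`-subsets `E` of `V`. -/
def co2 {V : Type*} [Fintype V] [DecidableEq V] (k : ℕ) (G : Finset (Finset V)) : ℕ :=
  ∑ E ∈ (Finset.univ : Finset V).powersetCard (k - 1), codegree G E ^ 2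

/-- `G` contains a copy of `H`: some injection of the vertices of `H` into the vertices of `G`
sends every edge of `H` to an edge of `G` (the copy need not be induced). -/
def Contains {V W : Type*} (G : Finset (Finset V)) (H : Finset (Finset W)) : Prop :=
  ∃ f : W ↪ V, ∀ e ∈ H, e.map f ∈ G

open Classical in
/-- The `k`-uniform hypergraphs on the vertex set `Fin n` that contain no copy of `H`. -/
noncomputable def freeHypergraphs {W : Type*} (k n : ℕ) (H : Finset (Finset W)) :
    Finset (Finset (Finset (Fin n))) :=
  ((Finset.univ : Finset (Fin n)).powersetCard k).powerset.filter fun G => ¬ Contains G H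

/-- The codegree squared extremal number: the maximum of `co₂(G)` over all `H`-free `k`-uniform
hypergraphs `G` on `n` vertices. -/
noncomputable def exco2 {W : Type*} (k n : ℕ) (H : Finset (Finset W)) : ℕ :=
  (freeHypergraphs k n H).sup (co2 k)

/-- The normalized codegree squared extremal number. -/
noncomputable def scaledExco2 {W : Type*} (k : ℕ) (H : Finset (Finset W)) (n : ℕ) : ℝ :=
  (exco2 k n H : ℝ) / ((n.choose (k - 1) : ℝ) * ((n : ℝ) - (k : ℝ) + 1) ^ 2)

/-- The codegree squared density `σ(H)`: the limit of the normalized codegree squared extremal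
numbers as the number of vertices tends to infinity. -/
noncomputable def sigma {W : Type*} (k : ℕ) (H : Finset (Finset W)) : ℝ :=
  Filter.limUnder Filter.atTop (scaledExco2 k H)

/-- The Fano plane as a 3-uniform hypergraph on 7 points: its lines are the translates of
`{0, 1, 3}` modulo 7. -/
def fano : Finset (Finset (Fin 7)) :=
  {{0, 1, 3}, {1, 2, 4}, {2, 3, 5}, {3, 4, 6}, {4, 5, 0}, {5, 6, 1}, {6, 0, 2}}

end CodegreeSquared

/-!
Averaging over vertex deletions shows that the normalized extremal numbers are eventually
non-increasing, so they converge.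

For the bound, let `G` be a Fano-free 3-uniform hypergraph on `N` vertices. If `G` contains no
complete 3-uniform hypergraph on four vertices, then double counting gives `co₂(G) ≤ N ^ 4 / 3`.
Otherwise consider the multigraph formed by the links of the four vertices of such a clique. Were
four vertices outside the clique to span more than 20 of its edges, Hall's theorem would assign
distinct clique vertices to the three perfect matchings of these four vertices, so that each
matching lies in the link assigned to it, which yields a Fano plane. Hence this multigraph has at
most `3 / 2 * N ^ 2` edges, and some link has at most `3 / 8 * N ^ 2`. By de Caen's inequality for
the link, deleting its vertex costs at most about `11 / 8 * N ^ 3`, and the bound `11 / 32 * N ^ 4`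
on `co₂(G)` follows, up to lower-order terms, by induction.
-/

open Finset

namespace CodegreeSquared

section Containment

variable {V W U : Type*} {H : Finset (Finset U)}

lemma Contains.map {G : Finset (Finset W)} (h : Contains G H) (f : W ↪ V) :
    Contains (G.map (mapEmbedding f).toEmbedding) H := by
  obtain ⟨g, hg⟩ := h
  exact ⟨g.trans f, fun e he => mem_map.2 ⟨e.map g, hg e he, map_map g f e⟩⟩

lemma Contains.mono {G G' : Finset (Finset V)} (h : Contains G H) (hGG' : G ⊆ G') :
    Contains G' H :=
  h.imp fun _ hf e he => hGG' (hf e he)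

end Containment

variable {V : Type*} [DecidableEq V] {G : Finset (Finset V)} {k : ℕ}

section Codegree

lemma codegree_nonMemberSubfamily_add (G : Finset (Finset V)) (v : V) (E : Finset V) :
    codegree (G.nonMemberSubfamily v) E + codegree G (insert v E) = codegree G E := by
  have hdel : {e ∈ G.nonMemberSubfamily v | E ⊆ e} = {e ∈ {e ∈ G | E ⊆ e} | ¬ v ∈ e} := by
    ext e; simp only [mem_filter, mem_nonMemberSubfamily]; tauto
  have hins : {e ∈ G | insert v E ⊆ e} = {e ∈ {e ∈ G | E ⊆ e} | v ∈ e} := by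
    ext e; simp only [mem_filter, insert_subset_iff]; tauto
  rw [codegree, codegree, hdel, hins, add_comm, card_filter_add_card_filter_not, codegree]

lemma codegree_memberSubfamily {v : V} {E : Finset V} (hv : v ∉ E) :
    codegree (G.memberSubfamily v) E = codegree G (insert v E) := by
  refine card_nbij' (insert v) (erase · v) ?_ ?_ ?_ ?_ <;> intro e he <;>
    simp only [coe_filter, Set.mem_ofPred_eq, mem_memberSubfamily] at he ⊢
  · exact ⟨he.1.1, insert_subset_insert v he.2⟩
  · have hve : v ∈ e := he.2 (mem_insert_self v E)
    exact ⟨⟨by rw [insert_erase hve]; exact he.1, notMem_erase v e⟩,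
      subset_erase.2 ⟨(subset_insert v E).trans he.2, hv⟩⟩
  · exact erase_insert he.1.2
  · exact insert_erase (he.2 (mem_insert_self v E))

lemma codegree_eq_zero_of_not_subset {T E : Finset V} (hT : ∀ e ∈ G, e ⊆ T) (hE : ¬ E ⊆ T) :
    codegree G E = 0 :=
  card_eq_zero.2 <| filter_eq_empty_iff.2 fun e he hEe => hE (hEe.trans (hT e he))

lemma codegree_eq_ite (hG : (G : Set (Finset V)).Sized k) {E : Finset V} (hE : #E = k) :
    codegree G E = if E ∈ G then 1 else 0 := by
  have : {e ∈ G | E ⊆ e} = {e ∈ G | e = E} := filter_congr fun e he =>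
    ⟨fun h => (eq_of_subset_of_card_le h (by rw [hG he, hE])).symm, fun h => h.ge⟩
  rw [codegree, this, filter_eq']
  split_ifs <;> simp

lemma sized_memberSubfamily (hG : (G : Set (Finset V)).Sized (k + 1)) (v : V) :
    (G.memberSubfamily v : Set (Finset V)).Sized k := by
  intro e he
  obtain ⟨hins, hv⟩ := mem_memberSubfamily.1 he
  have := hG hins
  rw [card_insert_of_notMem hv] at this
  exact Nat.succ_injective this

lemma sized_nonMemberSubfamily (hG : (G : Set (Finset V)).Sized k) (v : V) :
    (G.nonMemberSubfamily v : Set (Finset V)).Sized k :=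
  hG.mono fun _ he => (mem_nonMemberSubfamily.1 he).1

variable [Fintype V]

lemma codegree_eq_card_insert_mem (hG : (G : Set (Finset V)).Sized (k + 1)) {E : Finset V}
    (hE : #E = k) : codegree G E = #{v | v ∉ E ∧ insert v E ∈ G} := by
  symm
  refine card_nbij (insert · E) ?_ ?_ ?_
  · intro v hv
    simp only [coe_filter, mem_univ, true_and, Set.mem_ofPred_eq] at hv ⊢
    exact ⟨hv.2, subset_insert v E⟩
  · intro v hv u _ huv
    simp only [coe_filter, mem_univ, true_and, Set.mem_ofPred_eq] at hv
    exact (insert_inj hv.1).1 huv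
  · intro e he
    simp only [coe_filter, Set.mem_ofPred_eq] at he
    obtain ⟨v, hv, rfl⟩ := exists_eq_insert_iff.2 ⟨he.2, by rw [hE, hG he.1]⟩
    exact ⟨v, by simpa [hv] using he.1, rfl⟩

lemma codegree_singleton_eq_card (hG : (G : Set (Finset V)).Sized 2) (x : V) :
    codegree G {x} = #{y | {x, y} ∈ G} := by
  rw [codegree_eq_card_insert_mem hG (card_singleton x)]
  congr 1
  ext y
  simp only [mem_filter, mem_univ, true_and, mem_singleton, pair_comm y x, and_iff_right_iff_imp]
  rintro hxy rfl
  simpa using hG hxy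

lemma codegree_le_card_sub (hG : (G : Set (Finset V)).Sized (k + 1)) {E : Finset V}
    (hE : #E = k) : codegree G E ≤ Fintype.card V - k := by
  rw [codegree_eq_card_insert_mem hG hE, ← hE, ← card_compl]
  exact card_le_card fun v hv => mem_compl.2 (mem_filter.1 hv).2.1

lemma sum_codegree_mul (G : Finset (Finset V)) (j : ℕ) (f : Finset V → ℕ) :
    ∑ E ∈ powersetCard j univ, codegree G E * f E = ∑ e ∈ G, ∑ E ∈ powersetCard j e, f E := by
  simp_rw [codegree, ← smul_eq_mul, ← sum_const]
  refine sum_comm' fun E e => ?_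
  simp only [mem_powersetCard, mem_filter, subset_univ, true_and]
  tauto

lemma sum_codegree_singleton (hG : (G : Set (Finset V)).Sized k) :
    ∑ x, codegree G {x} = k * #G := by
  have h := sum_codegree_mul G 1 1
  simp only [powersetCard_one, sum_map, Function.Embedding.coeFn_mk, Pi.one_apply, mul_one,
    sum_const, smul_eq_mul, card_map] at h
  rw [h, sum_congr rfl fun e he => hG he, sum_const, smul_eq_mul, mul_comm]

lemma co2_eq_sum_edges (k : ℕ) (G : Finset (Finset V)) :
    co2 k G = ∑ e ∈ G, ∑ E ∈ powersetCard (k - 1) e, codegree G E := by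
  simp_rw [co2, sq, sum_codegree_mul]

lemma co2_eq_sum_powersetCard {T : Finset V} (hT : ∀ e ∈ G, e ⊆ T) (k : ℕ) :
    co2 k G = ∑ E ∈ powersetCard (k - 1) T, codegree G E ^ 2 := by
  refine (sum_subset (powersetCard_mono (subset_univ T)) fun E hE hET => ?_).symm
  have hsub : ¬ E ⊆ T := fun h => hET (mem_powersetCard.2 ⟨h, (mem_powersetCard.1 hE).2⟩)
  rw [codegree_eq_zero_of_not_subset hT hsub, zero_pow two_ne_zero]

lemma co2_two_eq_sum (G : Finset (Finset V)) : co2 2 G = ∑ x, codegree G {x} ^ 2 := by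
  simp [co2, powersetCard_one]

end Codegree

section Deletion

lemma codegree_nonMemberSubfamily_of_mem {v : V} {E : Finset V} (hv : v ∈ E) :
    codegree (G.nonMemberSubfamily v) E = 0 :=
  Nat.add_eq_right.1 <| by
    simpa only [insert_eq_of_mem hv] using codegree_nonMemberSubfamily_add G v E

lemma sq_codegree_nonMemberSubfamily (hG : (G : Set (Finset V)).Sized (k + 1)) {v : V}
    {E : Finset V} (hE : #E = k) (hv : v ∉ E) :
    codegree (G.nonMemberSubfamily v) E ^ 2 +
        2 * codegree G E * (if insert v E ∈ G then 1 else 0) =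
      codegree G E ^ 2 + if insert v E ∈ G then 1 else 0 := by
  rw [← codegree_nonMemberSubfamily_add G v E,
    codegree_eq_ite hG (by rw [card_insert_of_notMem hv, hE])]
  split_ifs <;> ring

variable [Fintype V]

lemma subset_erase_of_mem_nonMemberSubfamily {v : V} {e : Finset V}
    (he : e ∈ G.nonMemberSubfamily v) : e ⊆ univ.erase v :=
  subset_erase.2 ⟨subset_univ e, (mem_nonMemberSubfamily.1 he).2⟩

lemma subset_erase_of_mem_memberSubfamily {v : V} {e : Finset V}
    (he : e ∈ G.memberSubfamily v) : e ⊆ univ.erase v :=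
  subset_erase.2 ⟨subset_univ e, (mem_memberSubfamily.1 he).2⟩

lemma sum_sq_codegree_nonMemberSubfamily (hG : (G : Set (Finset V)).Sized (k + 1))
    {E : Finset V} (hE : #E = k) :
    ∑ v, codegree (G.nonMemberSubfamily v) E ^ 2 + 2 * codegree G E ^ 2 =
      (Fintype.card V - k) * codegree G E ^ 2 + codegree G E := by
  have hcodeg : codegree G E = ∑ v ∈ Eᶜ, if insert v E ∈ G then 1 else 0 := by
    rw [codegree_eq_card_insert_mem hG hE, sum_boole, Nat.cast_id]
    congr 1
    ext v
    simp
  have hinside : ∑ v ∈ E, codegree (G.nonMemberSubfamily v) E ^ 2 = 0 :=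
    sum_eq_zero fun v hv => by rw [codegree_nonMemberSubfamily_of_mem hv, zero_pow two_ne_zero]
  calc ∑ v, codegree (G.nonMemberSubfamily v) E ^ 2 + 2 * codegree G E ^ 2
      = ∑ v ∈ Eᶜ, (codegree (G.nonMemberSubfamily v) E ^ 2 +
          2 * codegree G E * (if insert v E ∈ G then 1 else 0)) := by
        rw [← sum_add_sum_compl E, hinside, zero_add, sum_add_distrib, ← mul_sum, ← hcodeg]
        ring
    _ = ∑ v ∈ Eᶜ, (codegree G E ^ 2 + if insert v E ∈ G then 1 else 0) :=
        sum_congr rfl fun v hv => sq_codegree_nonMemberSubfamily hG hE (mem_compl.1 hv)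
    _ = (Fintype.card V - k) * codegree G E ^ 2 + codegree G E := by
        rw [sum_add_distrib, ← hcodeg, sum_const, smul_eq_mul, card_compl, hE]

lemma sq_mul_sq_codegree_le (hG : (G : Set (Finset V)).Sized (k + 1)) {E : Finset V}
    (hE : #E = k) :
    (Fintype.card V - (k + 1)) ^ 2 * codegree G E ^ 2 ≤
      (Fintype.card V - k) * ∑ v, codegree (G.nonMemberSubfamily v) E ^ 2 := by
  have hsum := sum_sq_codegree_nonMemberSubfamily hG hE
  have hle := codegree_le_card_sub hG hE
  rw [← Nat.sub_sub]
  rcases Nat.eq_zero_or_pos (Fintype.card V - k) with h0 | hpos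
  · simp [h0]
  · obtain ⟨m, hm⟩ := Nat.exists_eq_add_of_le' hpos
    rw [hm] at hsum hle ⊢
    rw [Nat.add_sub_cancel]
    nlinarith [Nat.mul_le_mul_left (codegree G E) hle]

lemma sq_mul_co2_le_sum_nonMemberSubfamily (hG : (G : Set (Finset V)).Sized (k + 1)) :
    (Fintype.card V - (k + 1)) ^ 2 * co2 (k + 1) G ≤
      (Fintype.card V - k) * ∑ v, co2 (k + 1) (G.nonMemberSubfamily v) := by
  simp only [co2, Nat.add_sub_cancel]
  rw [sum_comm, mul_sum, mul_sum]
  exact sum_le_sum fun E hE => sq_mul_sq_codegree_le hG (mem_powersetCard.1 hE).2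

lemma co2_eq_sum_erase_add_co2_memberSubfamily (k : ℕ) (G : Finset (Finset V)) (v : V) :
    co2 (k + 2) G = ∑ E ∈ powersetCard (k + 1) (univ.erase v), codegree G E ^ 2 +
      co2 (k + 1) (G.memberSubfamily v) := by
  have hnotMem : ∀ {j} {E : Finset V}, E ∈ powersetCard j (univ.erase v) → v ∉ E := fun hE =>
    notMem_mono (mem_powersetCard.1 hE).1 (notMem_erase v univ)
  have hthrough : ∑ E ∈ (powersetCard k (univ.erase v)).image (insert v), codegree G E ^ 2 =
      co2 (k + 1) (G.memberSubfamily v) := by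
    rw [co2_eq_sum_powersetCard fun e he => subset_erase_of_mem_memberSubfamily he,
      sum_image fun E hE F hF => insert_erase_invOn.2.injOn (hnotMem hE) (hnotMem hF)]
    exact sum_congr rfl fun E hE => by rw [codegree_memberSubfamily (hnotMem hE)]
  rw [← hthrough, ← sum_union, ← powersetCard_succ_insert (notMem_erase v univ),
    insert_erase (mem_univ v)]
  · rfl
  · refine disjoint_left.2 fun E hE hE' => ?_
    obtain ⟨F, -, rfl⟩ := mem_image.1 hE'
    exact hnotMem hE (mem_insert_self v F)

lemma sum_memberSubfamily (hG : (G : Set (Finset V)).Sized (k + 1)) (v : V)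
    (f : Finset V → ℕ) :
    ∑ E ∈ G.memberSubfamily v, f E =
      ∑ E ∈ powersetCard k (univ.erase v), f E * if insert v E ∈ G then 1 else 0 := by
  simp only [mul_ite, mul_one, mul_zero]
  rw [← sum_filter]
  refine sum_congr ?_ fun _ _ => rfl
  ext E
  simp only [mem_memberSubfamily, mem_filter, mem_powersetCard, subset_erase, subset_univ,
    true_and]
  refine ⟨fun hE => ⟨⟨hE.2, ?_⟩, hE.1⟩, fun hE => ⟨hE.2, hE.1.1⟩⟩
  exact sized_memberSubfamily hG v (mem_memberSubfamily.2 hE)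

lemma co2_add_card_memberSubfamily (hG : (G : Set (Finset V)).Sized (k + 2)) (v : V) :
    co2 (k + 2) G + #(G.memberSubfamily v) =
      co2 (k + 2) (G.nonMemberSubfamily v) + co2 (k + 1) (G.memberSubfamily v) +
        2 * ∑ E ∈ G.memberSubfamily v, codegree G E := by
  have havoid : ∑ E ∈ powersetCard (k + 1) (univ.erase v), codegree G E ^ 2 +
        #(G.memberSubfamily v) =
      co2 (k + 2) (G.nonMemberSubfamily v) + 2 * ∑ E ∈ G.memberSubfamily v, codegree G E := by
    rw [card_eq_sum_ones, sum_memberSubfamily hG, sum_memberSubfamily hG, mul_sum,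
      co2_eq_sum_powersetCard fun e he => subset_erase_of_mem_nonMemberSubfamily he,
      ← sum_add_distrib, Nat.add_sub_cancel_right (n := k + 1) (m := 1), ← sum_add_distrib]
    refine sum_congr rfl fun E hE => ?_
    obtain ⟨hEv, hcard⟩ := mem_powersetCard.1 hE
    rw [one_mul, ← mul_assoc,
      sq_codegree_nonMemberSubfamily hG hcard (notMem_mono hEv (notMem_erase v univ))]
  rw [co2_eq_sum_erase_add_co2_memberSubfamily k G v]
  omega

end Deletion

section ExtremalNumber

variable {W U : Type*} [DecidableEq W] {H : Finset (Finset U)}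

lemma codegree_map (f : W ↪ V) (G : Finset (Finset W)) (E : Finset W) :
    codegree (G.map (mapEmbedding f).toEmbedding) (E.map f) = codegree G E := by
  simp only [codegree, filter_map, card_map, Function.comp_def, RelEmbedding.coe_toEmbedding,
    mapEmbedding_apply, map_subset_map]

lemma co2_map [Fintype V] [Fintype W] (f : W ↪ V) (k : ℕ) (G : Finset (Finset W)) :
    co2 k (G.map (mapEmbedding f).toEmbedding) = co2 k G := by
  have hrange : ∀ e ∈ G.map (mapEmbedding f).toEmbedding, e ⊆ univ.map f := by
    simp only [forall_mem_map]
    exact fun e _ => map_subset_map.2 (subset_univ e)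
  rw [co2_eq_sum_powersetCard hrange, powersetCard_map, sum_map]
  simp only [RelEmbedding.coe_toEmbedding, mapEmbedding_apply, codegree_map, co2]

lemma mem_freeHypergraphs {n : ℕ} {G : Finset (Finset (Fin n))} :
    G ∈ freeHypergraphs k n H ↔ (G : Set (Finset (Fin n))).Sized k ∧ ¬ Contains G H := by
  simp only [freeHypergraphs, mem_filter, mem_powerset, subset_powersetCard_univ_iff]

lemma mul_exco2_le {n c B : ℕ} (h : ∀ G : Finset (Finset (Fin n)),
    (G : Set (Finset (Fin n))).Sized k → ¬ Contains G H → c * co2 k G ≤ B) :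
    c * exco2 k n H ≤ B :=
  sup_induction (p := fun x => c * x ≤ B) (Nat.zero_le B)
    (fun x hx y hy => by rcases max_choice x y with h | h <;> simpa only [h])
    fun G hG => (mem_freeHypergraphs.1 hG).elim (h G)

lemma co2_le_exco2 [Fintype V] (hG : (G : Set (Finset V)).Sized k) (hH : ¬ Contains G H)
    {T : Finset V} (hT : ∀ e ∈ G, e ⊆ T) : co2 k G ≤ exco2 k #T H := by
  let f : Fin #T ↪ V := T.equivFin.symm.toEmbedding.trans (Function.Embedding.subtype _)
  have hf : univ.map f = T := by
    rw [← map_map, univ_map_equiv_to_embedding, univ_eq_attach, attach_map_val]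
  let G' : Finset (Finset (Fin #T)) := G.preimage (Finset.map f) (map_injective f).injOn
  have hG' : G'.map (mapEmbedding f).toEmbedding = G := by
    ext e
    simp only [G', mem_map, mem_preimage, RelEmbedding.coe_toEmbedding, mapEmbedding_apply]
    refine ⟨by rintro ⟨e', he', rfl⟩; exact he', fun he => ?_⟩
    obtain ⟨e', -, rfl⟩ := subset_map_iff.1 (hf.symm ▸ hT e he)
    exact ⟨e', he, rfl⟩
  have hfree : G' ∈ freeHypergraphs k #T H := mem_freeHypergraphs.2
    ⟨fun e he => by simpa using hG (mem_preimage.1 he), fun h => hH (hG' ▸ h.map f)⟩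
  calc co2 k G = co2 k G' := by rw [← co2_map f, hG']
    _ ≤ exco2 k #T H := le_sup (f := co2 k) hfree

lemma co2_nonMemberSubfamily_le_exco2 [Fintype V] (hG : (G : Set (Finset V)).Sized k)
    (hH : ¬ Contains G H) (v : V) :
    co2 k (G.nonMemberSubfamily v) ≤ exco2 k (Fintype.card V - 1) H := by
  rw [← card_univ, ← card_erase_of_mem (mem_univ v)]
  exact co2_le_exco2 (sized_nonMemberSubfamily hG v)
    (fun h => hH (h.mono fun _ he => (mem_nonMemberSubfamily.1 he).1))
    fun e he => subset_erase_of_mem_nonMemberSubfamily he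

lemma sq_mul_exco2_succ_le (k n : ℕ) (H : Finset (Finset U)) :
    (n - k) ^ 2 * exco2 (k + 1) (n + 1) H ≤ (n + 1 - k) * ((n + 1) * exco2 (k + 1) n H) := by
  refine mul_exco2_le fun G hG hH => ?_
  have hsum : ∑ v, co2 (k + 1) (G.nonMemberSubfamily v) ≤ (n + 1) * exco2 (k + 1) n H := by
    simpa using sum_le_card_nsmul univ _ _ fun v _ => co2_nonMemberSubfamily_le_exco2 hG hH v
  have hdel := sq_mul_co2_le_sum_nonMemberSubfamily hG
  rw [Fintype.card_fin, Nat.add_sub_add_right] at hdel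
  exact hdel.trans (Nat.mul_le_mul_left _ hsum)

end ExtremalNumber

section Density

variable {U : Type*}

lemma scaledExco2_nonneg (k n : ℕ) (H : Finset (Finset U)) : 0 ≤ scaledExco2 k H n := by
  unfold scaledExco2; positivity

lemma scaledExco2_succ_le {n : ℕ} (hkn : k < n) (H : Finset (Finset U)) :
    scaledExco2 (k + 1) H (n + 1) ≤ scaledExco2 (k + 1) H n := by
  obtain ⟨m, rfl⟩ := Nat.exists_eq_add_of_lt hkn
  have hrec : ((m : ℝ) + 1) ^ 2 * exco2 (k + 1) (k + m + 1 + 1) H ≤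
      (m + 2) * ((k + m + 2) * exco2 (k + 1) (k + m + 1) H) := by
    have := sq_mul_exco2_succ_le k (k + m + 1) H
    rw [show k + m + 1 - k = m + 1 by omega, show k + m + 1 + 1 - k = m + 2 by omega] at this
    exact_mod_cast this
  have hchoose : ((k + m + 1).choose k : ℝ) * (k + m + 2) =
      (k + m + 1 + 1).choose k * (m + 2) := by
    have := Nat.choose_mul_succ_eq (k + m + 1) k
    rw [show k + m + 1 + 1 - k = m + 2 by omega] at this
    exact_mod_cast this
  have hpos : ∀ j, (0 : ℝ) < (k + j).choose k := fun j => by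
    exact_mod_cast Nat.choose_pos (Nat.le_add_right k j)
  have hpos₁ := hpos (m + 1)
  have hpos₂ := hpos (m + 2)
  simp only [scaledExco2, Nat.add_sub_cancel]
  push_cast
  rw [show (k + m + 1 + 1 - (k + 1) + 1 : ℝ) = m + 2 by ring,
    show (k + m + 1 - (k + 1) + 1 : ℝ) = m + 1 by ring,
    div_le_div_iff₀ (by positivity) (by positivity)]
  calc _ = ((k + m + 1).choose k : ℝ) * ((m + 1) ^ 2 * exco2 (k + 1) (k + m + 1 + 1) H) := by ring
    _ ≤ (k + m + 1).choose k * ((m + 2) * ((k + m + 2) * exco2 (k + 1) (k + m + 1) H)) := by gcongr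
    _ = (k + m + 1).choose k * (k + m + 2) * ((m + 2) * exco2 (k + 1) (k + m + 1) H) := by ring
    _ = _ := by rw [hchoose]; ring

lemma tendsto_scaledExco2 (k : ℕ) (H : Finset (Finset U)) :
    Filter.Tendsto (scaledExco2 (k + 1) H) Filter.atTop (nhds (sigma (k + 1) H)) := by
  have hanti : Antitone fun n => scaledExco2 (k + 1) H (n + (k + 1)) :=
    antitone_nat_of_succ_le fun n => by
      rw [add_right_comm]
      exact scaledExco2_succ_le (by omega) H
  have hbdd : BddBelow (Set.range fun n => scaledExco2 (k + 1) H (n + (k + 1))) :=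
    ⟨0, Set.forall_mem_range.2 fun n => scaledExco2_nonneg _ _ H⟩
  exact tendsto_nhds_limUnder
    ⟨_, (Filter.tendsto_add_atTop_iff_nat (k + 1)).1 (tendsto_atTop_ciInf hanti hbdd)⟩

end Density

section CliqueFree

lemma card_filter_insert_mem_le (hk : k ≠ 0)
    (hfree : ∀ S, #S = k + 2 → ¬ powersetCard (k + 1) S ⊆ G)
    {e : Finset V} (he : e ∈ G) (hcard : #e = k + 1) (v : V) :
    #{E ∈ powersetCard k e | v ∉ E ∧ insert v E ∈ G} ≤ k := by
  by_cases hv : v ∈ e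
  · have hsub : {E ∈ powersetCard k e | v ∉ E ∧ insert v E ∈ G} ⊆ {e.erase v} := by
      intro E hE
      simp only [mem_filter, mem_powersetCard] at hE
      refine mem_singleton.2 (eq_of_subset_of_card_le (subset_erase.2 ⟨hE.1.1, hE.2.1⟩) ?_)
      rw [card_erase_of_mem hv, hcard, hE.1.2, Nat.add_sub_cancel]
    calc _ ≤ #{e.erase v} := card_le_card hsub
      _ ≤ k := Nat.one_le_iff_ne_zero.2 hk
  · have hP : #(powersetCard k e) = k + 1 := by
      rw [card_powersetCard, hcard, Nat.choose_succ_self_right]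
    refine Nat.le_of_lt_succ ((card_filter_le _ _).trans_eq hP |>.lt_of_ne fun h => ?_)
    have hall := card_filter_eq_iff.1 (h.trans hP.symm)
    refine hfree (insert v e) (by rw [card_insert_of_notMem hv, hcard]) ?_
    have hself : powersetCard (k + 1) e = {e} := hcard ▸ powersetCard_self e
    rw [powersetCard_succ_insert hv, hself, union_subset_iff, singleton_subset_iff,
      image_subset_iff]
    exact ⟨he, fun E hE => (hall E hE).2⟩

variable [Fintype V]

lemma co2_le_of_forall_not_powersetCard_subset (hG : (G : Set (Finset V)).Sized (k + 1))
    (hk : k ≠ 0) (hfree : ∀ S, #S = k + 2 → ¬ powersetCard (k + 1) S ⊆ G) :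
    co2 (k + 1) G ≤ #G * (k * Fintype.card V) := by
  rw [co2_eq_sum_edges, Nat.add_sub_cancel, ← smul_eq_mul]
  refine sum_le_card_nsmul _ _ _ fun e he => ?_
  calc ∑ E ∈ powersetCard k e, codegree G E
      = ∑ E ∈ powersetCard k e, #{v | v ∉ E ∧ insert v E ∈ G} :=
        sum_congr rfl fun E hE => codegree_eq_card_insert_mem hG (mem_powersetCard.1 hE).2
    _ = ∑ v, #{E ∈ powersetCard k e | v ∉ E ∧ insert v E ∈ G} :=
        sum_card_bipartiteAbove_eq_sum_card_bipartiteBelow fun E v => v ∉ E ∧ insert v E ∈ G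
    _ ≤ ∑ _v : V, k := sum_le_sum fun v _ => card_filter_insert_mem_le hk hfree he (hG he) v
    _ = k * Fintype.card V := by rw [sum_const, smul_eq_mul, card_univ, mul_comm]

end CliqueFree

section Graph

variable [Fintype V] {L : Finset (Finset V)}

lemma sum_sum_codegree_singleton (hL : (L : Set (Finset V)).Sized 2) :
    ∑ x, ∑ y with {x, y} ∈ L, codegree L {y} = co2 2 L := by
  rw [co2_two_eq_sum, sum_comm' (t' := univ) (s' := fun y => {x | {y, x} ∈ L})
    fun x y => by simp only [mem_univ, true_and, mem_filter, and_true, pair_comm]]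
  exact sum_congr rfl fun y _ => by
    rw [sum_const, smul_eq_mul, ← codegree_singleton_eq_card hL, sq]

/-- The neighbours of `x` have total degree at most `2 * #L` and at most `d * card V`, where `d` is
the degree of `x`; the bound is the average of the two with weights `d` and `card V - d`. -/
lemma card_mul_sum_codegree_add_le (hL : (L : Set (Finset V)).Sized 2) (x : V) :
    Fintype.card V * ∑ y with {x, y} ∈ L, codegree L {y} +
        Fintype.card V * codegree L {x} ^ 2 ≤
      2 * #L * codegree L {x} + Fintype.card V ^ 2 * codegree L {x} := by
  have hdeg : ∀ y, codegree L {y} ≤ Fintype.card V := fun y =>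
    (codegree_le_card_sub hL (card_singleton y)).trans (Nat.sub_le _ _)
  have hedges : ∑ y with {x, y} ∈ L, codegree L {y} ≤ 2 * #L :=
    (sum_le_univ_sum_of_nonneg fun _ => Nat.zero_le _).trans_eq (sum_codegree_singleton hL)
  have hnbrs : ∑ y with {x, y} ∈ L, codegree L {y} ≤ codegree L {x} * Fintype.card V := by
    rw [codegree_singleton_eq_card hL x, ← smul_eq_mul]
    exact sum_le_card_nsmul _ _ _ fun y _ => hdeg y
  obtain ⟨m, hm⟩ := Nat.exists_eq_add_of_le (hdeg x)
  rw [hm] at hnbrs ⊢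
  linarith [Nat.mul_le_mul_left (codegree L {x}) hedges, Nat.mul_le_mul_left m hnbrs]

/-- A weak form of de Caen's inequality. -/
lemma card_mul_co2_two_le (hL : (L : Set (Finset V)).Sized 2) :
    Fintype.card V * co2 2 L ≤ 2 * #L ^ 2 + Fintype.card V ^ 2 * #L := by
  have h := sum_le_sum fun x (_ : x ∈ univ) => card_mul_sum_codegree_add_le hL x
  simp only [sum_add_distrib, ← mul_sum] at h
  rw [sum_sum_codegree_singleton hL, ← co2_two_eq_sum, sum_codegree_singleton hL] at h
  linarith

end Graph

section Multigraph

variable {α : Type*} {w : α → α → ℕ}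

lemma sum_sum_insert [DecidableEq α] (hsymm : ∀ x y, w x y = w y x) {t : α} {T : Finset α}
    (ht : t ∉ T) :
    ∑ x ∈ insert t T, ∑ y ∈ insert t T, w x y =
      ∑ x ∈ T, ∑ y ∈ T, w x y + 2 * ∑ y ∈ T, w t y + w t t := by
  simp only [sum_insert ht, sum_add_distrib, hsymm _ t]
  ring

lemma sum_sum_four [DecidableEq α] (hsymm : ∀ x y, w x y = w y x) (hdiag : ∀ x, w x x = 0)
    {x y z t : α} (hxy : x ≠ y) (hxz : x ≠ z) (hxt : x ≠ t) (hyz : y ≠ z) (hyt : y ≠ t)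
    (hzt : z ≠ t) :
    ∑ p ∈ {x, y, z, t}, ∑ q ∈ {x, y, z, t}, w p q =
      2 * (w x y + w z t + w t x + w y z + w t y + w x z) := by
  have hx : x ∉ ({y, z, t} : Finset α) := by simp [hxy, hxz, hxt]
  have hy : y ∉ ({z, t} : Finset α) := by simp [hyz, hyt]
  rw [sum_sum_insert hsymm hx, sum_sum_insert hsymm hy, sum_sum_insert hsymm (by simpa using hzt),
    sum_insert hy, sum_pair hzt, sum_pair hzt, hsymm t x, hsymm t y]
  simp only [sum_singleton, hdiag]
  ring

lemma sum_sum_le_of_sdiff [DecidableEq α] (hsymm : ∀ x y, w x y = w y x) {c : ℕ}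
    {T W : Finset α} (hTW : T ⊆ W)
    (hrest : ∑ x ∈ W \ T, ∑ y ∈ W \ T, w x y ≤ c * #(W \ T) ^ 2)
    (hcross : ∀ x ∈ W \ T, ∑ y ∈ T, w x y ≤ c * #T)
    (hT : ∑ x ∈ T, ∑ y ∈ T, w x y ≤ c * #T ^ 2) :
    ∑ x ∈ W, ∑ y ∈ W, w x y ≤ c * #W ^ 2 := by
  have hcross' : ∑ x ∈ W \ T, ∑ y ∈ T, w x y ≤ #(W \ T) * (c * #T) :=
    sum_le_card_nsmul _ _ _ hcross
  have hcomm : ∑ x ∈ T, ∑ y ∈ W \ T, w x y = ∑ x ∈ W \ T, ∑ y ∈ T, w x y := by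
    rw [sum_comm]
    simp only [hsymm]
  simp only [← sum_sdiff hTW, ← card_sdiff_add_card_eq_card hTW, sum_add_distrib]
  rw [hcomm]
  linarith

lemma sum_sum_le_of_forall_le (hdiag : ∀ x, w x x = 0) {c : ℕ} (hw : ∀ x y, w x y ≤ c)
    (T : Finset α) : ∑ x ∈ T, ∑ y ∈ T, w x y ≤ #T * ((#T - 1) * c) := by
  classical
  refine sum_le_card_nsmul _ _ _ fun x hx => ?_
  rw [← add_sum_erase T (w x) hx, hdiag, zero_add, ← card_erase_of_mem hx]
  exact sum_le_card_nsmul _ _ _ fun y _ => hw x y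

lemma sum_sum_le_of_forall_pair_lt (hsymm : ∀ x y, w x y = w y x) (hdiag : ∀ x, w x x = 0) {c : ℕ}
    {W : Finset α} (hpair : ∀ T ⊆ W, #T = 2 → ∑ x ∈ T, ∑ y ∈ T, w x y < 2 * (c + 1)) :
    ∑ x ∈ W, ∑ y ∈ W, w x y ≤ c * #W ^ 2 := by
  classical
  have hw : ∀ x ∈ W, ∀ y ∈ W, w x y ≤ c := by
    intro x hx y hy
    rcases eq_or_ne x y with rfl | hxy
    · rw [hdiag]
      exact c.zero_le
    · have := hpair {x, y} (insert_subset hx (singleton_subset_iff.2 hy)) (card_pair hxy)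
      rw [sum_pair hxy, sum_pair hxy, sum_pair hxy, hdiag, hdiag, hsymm y x] at this
      omega
  calc ∑ x ∈ W, ∑ y ∈ W, w x y ≤ ∑ _x ∈ W, ∑ _y ∈ W, c :=
        sum_le_sum fun x hx => sum_le_sum fun y hy => hw x hx y hy
    _ = c * #W ^ 2 := by
        simp only [sum_const, smul_eq_mul]
        ring

/-- The double sums count every edge of the multigraph twice. Peel off a triple spanning at least 11
edges, to which every other vertex sends at most 9, or else a pair of multiplicity 4, to which every
other vertex sends at most 6; if there is neither, all multiplicities are at most 3. -/
lemma sum_sum_le_of_forall_four (hsymm : ∀ x y, w x y = w y x) (hdiag : ∀ x, w x x = 0)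
    (hw : ∀ x y, w x y ≤ 4) (W : Finset α)
    (hfour : ∀ T ⊆ W, #T = 4 → ∑ x ∈ T, ∑ y ∈ T, w x y ≤ 40) :
    ∑ x ∈ W, ∑ y ∈ W, w x y ≤ 3 * #W ^ 2 := by
  classical
  induction W using Finset.strongInduction with
  | H W ih =>
  have hremove : ∀ T ⊆ W, T.Nonempty → ∑ x ∈ T, ∑ y ∈ T, w x y ≤ 3 * #T ^ 2 →
      (∀ t ∈ W \ T, ∑ y ∈ T, w t y ≤ 3 * #T) → ∑ x ∈ W, ∑ y ∈ W, w x y ≤ 3 * #W ^ 2 :=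
    fun T hTW hne hT hcross => sum_sum_le_of_sdiff hsymm hTW
      (ih _ (sdiff_ssubset hTW hne) fun T' hT' => hfour T' (hT'.trans sdiff_subset)) hcross hT
  have hinsert : ∀ T ⊆ W, ∀ t ∈ W \ T, insert t T ⊆ W ∧ #(insert t T) = #T + 1 ∧
      ∑ x ∈ insert t T, ∑ y ∈ insert t T, w x y =
        ∑ x ∈ T, ∑ y ∈ T, w x y + 2 * ∑ y ∈ T, w t y := by
    intro T hTW t ht
    obtain ⟨htW, htT⟩ := mem_sdiff.1 ht
    exact ⟨insert_subset htW hTW, card_insert_of_notMem htT,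
      by rw [sum_sum_insert hsymm htT, hdiag, add_zero]⟩
  by_cases hthree : ∃ T ⊆ W, #T = 3 ∧ 22 ≤ ∑ x ∈ T, ∑ y ∈ T, w x y
  · obtain ⟨T, hTW, hcard, hlarge⟩ := hthree
    have hT := sum_sum_le_of_forall_le hdiag hw T
    rw [hcard] at hT
    refine hremove T hTW (card_pos.1 (by omega)) (by rw [hcard]; omega) fun t ht => ?_
    obtain ⟨hsub, hcard', hsum⟩ := hinsert T hTW t ht
    have := hfour _ hsub (by rw [hcard', hcard])
    omega
  push Not at hthree
  by_cases htwo : ∃ T ⊆ W, #T = 2 ∧ 8 ≤ ∑ x ∈ T, ∑ y ∈ T, w x y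
  · obtain ⟨T, hTW, hcard, hlarge⟩ := htwo
    have hT := sum_sum_le_of_forall_le hdiag hw T
    rw [hcard] at hT
    refine hremove T hTW (card_pos.1 (by omega)) (by rw [hcard]; omega) fun t ht => ?_
    obtain ⟨hsub, hcard', hsum⟩ := hinsert T hTW t ht
    have := hthree _ hsub (by rw [hcard', hcard])
    omega
  push Not at htwo
  exact sum_sum_le_of_forall_pair_lt hsymm hdiag htwo

end Multigraph

lemma exists_injective_forall_mem_of_sum_card_sdiff_lt {ι : Type*} [Fintype ι]
    {C : ι → Finset V} {S : Finset V} (hcard : Fintype.card ι ≤ #S)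
    (hlt : ∑ i, #(S \ C i) < #S) :
    ∃ f : ι → V, Function.Injective f ∧ ∀ i, f i ∈ C i := by
  refine (all_card_le_biUnion_card_iff_exists_injective C).1 fun s => ?_
  by_contra! hs
  have hspos : 1 ≤ #s := (Nat.zero_le _).trans_lt hs
  have hsle : #s ≤ #S := s.card_le_univ.trans hcard
  have hmissed : #s * #(S \ s.biUnion C) < #S :=
    calc #s * #(S \ s.biUnion C) ≤ ∑ i ∈ s, #(S \ C i) :=
          card_nsmul_le_sum _ _ _ fun i hi =>
            card_le_card (sdiff_subset_sdiff Subset.rfl (subset_biUnion_of_mem C hi))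
      _ ≤ ∑ i, #(S \ C i) := sum_le_univ_sum_of_nonneg fun _ => Nat.zero_le _
      _ < #S := hlt
  obtain ⟨j, hj⟩ := Nat.exists_eq_add_of_le hspos
  obtain ⟨m, hm⟩ := Nat.exists_eq_add_of_le hsle
  have hcover := le_card_sdiff (s.biUnion C) S
  have : m + 1 ≤ #(S \ s.biUnion C) := by omega
  have := Nat.mul_le_mul_left #s this
  rw [hm, hj] at hmissed
  rw [hj] at this
  nlinarith

section Fano

lemma contains_fano_of_forall_mem {p : Fin 7 → V} (hp : Function.Injective p)
    (hlines : ∀ i, {p i, p (i + 1), p (i + 3)} ∈ G) : Contains G fano := by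
  have hfano : fano = univ.image fun i : Fin 7 => {i, i + 1, i + 3} := by decide
  refine ⟨⟨p, hp⟩, fun e he => ?_⟩
  obtain ⟨i, -, rfl⟩ := mem_image.1 (hfano ▸ he)
  simpa only [map_insert, map_singleton, Function.Embedding.coeFn_mk] using hlines i

/-- The Fano plane is a line together with the three perfect matchings of the four points off it,
each matching being joined to one point of the line. -/
lemma contains_fano_of_matchings {a b c x y z t : V} (hnodup : [a, b, t, c, x, y, z].Nodup)
    (habc : {a, b, c} ∈ G) (ha : {{x, y}, {z, t}} ⊆ G.memberSubfamily a)
    (hb : {{t, x}, {y, z}} ⊆ G.memberSubfamily b) (hc : {{t, y}, {x, z}} ⊆ G.memberSubfamily c) :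
    Contains G fano := by
  simp only [insert_subset_iff, singleton_subset_iff, mem_memberSubfamily] at ha hb hc
  have htcy : {t, c, y} ∈ G := insert_comm t c {y} ▸ hc.1.1
  have hxya : {x, y, a} ∈ G := by rw [pair_comm, insert_comm]; exact ha.1.1
  have hyzb : {y, z, b} ∈ G := by rw [pair_comm, insert_comm]; exact hb.2.1
  have hzat : {z, a, t} ∈ G := insert_comm z a {t} ▸ ha.2.1
  refine contains_fano_of_forall_mem (List.nodup_iff_injective_get.1 hnodup) fun i => ?_
  fin_cases i
  exacts [habc, hb.1.1, htcy, hc.2.1, hxya, hyzb, hzat]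

/-- The number of vertices in `S` whose link in `G` contains the pair `{x, y}`: the multiplicity of
`xy` in the multigraph formed by the links of the vertices of `S`. -/
def linkMultiplicity (G : Finset (Finset V)) (S : Finset V) (x y : V) : ℕ :=
  #{v ∈ S | {x, y} ∈ G.memberSubfamily v}

variable {S : Finset V}

lemma linkMultiplicity_comm (G : Finset (Finset V)) (S : Finset V) (x y : V) :
    linkMultiplicity G S x y = linkMultiplicity G S y x := by
  rw [linkMultiplicity, pair_comm, linkMultiplicity]

lemma linkMultiplicity_le_card (G : Finset (Finset V)) (S : Finset V) (x y : V) :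
    linkMultiplicity G S x y ≤ #S :=
  card_filter_le _ _

lemma linkMultiplicity_self (hG : (G : Set (Finset V)).Sized 3) (S : Finset V) (x : V) :
    linkMultiplicity G S x x = 0 := by
  refine card_eq_zero.2 (filter_eq_empty_iff.2 fun v _ h => ?_)
  simpa using sized_memberSubfamily hG v h

lemma linkMultiplicity_lt_card {x y : V} (hy : y ∈ S) :
    linkMultiplicity G S x y < #S := by
  refine card_lt_card (filter_ssubset.2 ⟨y, hy, fun h => (mem_memberSubfamily.1 h).2 ?_⟩)
  exact mem_insert_of_mem (mem_singleton_self y)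

lemma sum_sum_linkMultiplicity [Fintype V] (hG : (G : Set (Finset V)).Sized 3)
    (S : Finset V) :
    ∑ x, ∑ y, linkMultiplicity G S x y = 2 * ∑ v ∈ S, #(G.memberSubfamily v) := by
  calc ∑ x, ∑ y, linkMultiplicity G S x y
      = ∑ x, ∑ v ∈ S, #{y | {x, y} ∈ G.memberSubfamily v} := by
        simp only [linkMultiplicity, card_filter]
        exact sum_congr rfl fun x _ => sum_comm
    _ = ∑ v ∈ S, ∑ x, codegree (G.memberSubfamily v) {x} := by
        rw [sum_comm]
        exact sum_congr rfl fun v _ => sum_congr rfl fun x _ =>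
          (codegree_singleton_eq_card (sized_memberSubfamily hG v) x).symm
    _ = 2 * ∑ v ∈ S, #(G.memberSubfamily v) := by
        rw [mul_sum]
        exact sum_congr rfl fun v _ => sum_codegree_singleton (sized_memberSubfamily hG v)

lemma card_sdiff_add_linkMultiplicity_le (G : Finset (Finset V)) (S : Finset V) (x y z t : V) :
    #(S \ {v ∈ S | {{x, y}, {z, t}} ⊆ G.memberSubfamily v}) + linkMultiplicity G S x y +
      linkMultiplicity G S z t ≤ 2 * #S := by
  have hxy := card_filter_add_card_filter_not (s := S) fun v => {x, y} ∈ G.memberSubfamily v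
  have hzt := card_filter_add_card_filter_not (s := S) fun v => {z, t} ∈ G.memberSubfamily v
  have hunion : #(S \ {v ∈ S | {{x, y}, {z, t}} ⊆ G.memberSubfamily v}) ≤
      #{v ∈ S | {x, y} ∉ G.memberSubfamily v} + #{v ∈ S | {z, t} ∉ G.memberSubfamily v} := by
    simp only [← filter_not, insert_subset_iff, singleton_subset_iff, not_and_or, filter_or]
    exact card_union_le _ _
  rw [linkMultiplicity, linkMultiplicity]
  omega

lemma sum_sum_linkMultiplicity_le (hG : (G : Set (Finset V)).Sized 3)
    (hfano : ¬ Contains G fano) (hS : #S = 4) (hclique : powersetCard 3 S ⊆ G) {T : Finset V}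
    (hT : #T = 4) (hST : Disjoint S T) :
    ∑ x ∈ T, ∑ y ∈ T, linkMultiplicity G S x y ≤ 40 := by
  obtain ⟨x, y, z, t, hxy, hxz, hxt, hyz, hyt, hzt, rfl⟩ := card_eq_four.1 hT
  by_contra! hlarge
  let M : Fin 3 → Finset (Finset V) :=
    ![{{x, y}, {z, t}}, {{t, x}, {y, z}}, {{t, y}, {x, z}}]
  have hmissed : ∑ i, #(S \ {v ∈ S | M i ⊆ G.memberSubfamily v}) < #S := by
    rw [sum_sum_four (linkMultiplicity_comm G S) (linkMultiplicity_self hG S) hxy hxz hxt hyz hyt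
      hzt] at hlarge
    have h₀ : #(S \ {v ∈ S | M 0 ⊆ G.memberSubfamily v}) + _ + _ ≤ _ :=
      card_sdiff_add_linkMultiplicity_le G S x y z t
    have h₁ : #(S \ {v ∈ S | M 1 ⊆ G.memberSubfamily v}) + _ + _ ≤ _ :=
      card_sdiff_add_linkMultiplicity_le G S t x y z
    have h₂ : #(S \ {v ∈ S | M 2 ⊆ G.memberSubfamily v}) + _ + _ ≤ _ :=
      card_sdiff_add_linkMultiplicity_le G S t y x z
    rw [Fin.sum_univ_three]
    omega
  obtain ⟨f, hf, hmem⟩ := exists_injective_forall_mem_of_sum_card_sdiff_lt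
    (by rw [hS, Fintype.card_fin]; decide) hmissed
  have hfS : ∀ i, f i ∈ S := fun i => (mem_filter.1 (hmem i)).1
  have hne : ∀ i, ∀ u ∈ ({x, y, z, t} : Finset V), f i ≠ u := fun i _ hu =>
    disjoint_iff_ne.1 hST _ (hfS i) _ hu
  have h01 : f 0 ≠ f 1 := hf.ne (by decide)
  have h02 : f 0 ≠ f 2 := hf.ne (by decide)
  have h12 : f 1 ≠ f 2 := hf.ne (by decide)
  refine hfano (contains_fano_of_matchings ?_ (hclique (mem_powersetCard.2 ⟨?_, ?_⟩))
    (mem_filter.1 (hmem 0)).2 (mem_filter.1 (hmem 1)).2 (mem_filter.1 (hmem 2)).2)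
  · simp only [mem_insert, mem_singleton, forall_eq_or_imp, forall_eq] at hne
    simp [h01, h02, h12, hxy, hxz, hyz, hne, hxt.symm, hyt.symm, hzt.symm, (hne _).2.2.2.symm]
  · simp only [insert_subset_iff, singleton_subset_iff, hfS, and_self]
  · exact card_eq_three.2 ⟨_, _, _, h01, h02, h12, rfl⟩

lemma exists_card_memberSubfamily_le [Fintype V] (hG : (G : Set (Finset V)).Sized 3)
    (hfano : ¬ Contains G fano) (hS : #S = 4) (hclique : powersetCard 3 S ⊆ G) :
    ∃ v, 8 * #(G.memberSubfamily v) ≤ 3 * Fintype.card V ^ 2 := by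
  have hbound : ∑ x, ∑ y, linkMultiplicity G S x y ≤ 3 * #(univ : Finset V) ^ 2 := by
    have hcomm := linkMultiplicity_comm G S
    have hcross : ∀ x, ∑ y ∈ S, linkMultiplicity G S x y ≤ 3 * #S := fun x => by
      rw [mul_comm]
      exact sum_le_card_nsmul _ _ _ fun y hy =>
        Nat.le_of_lt_succ ((linkMultiplicity_lt_card hy).trans_eq hS)
    refine sum_sum_le_of_sdiff hcomm (subset_univ S) ?_ (fun x _ => hcross x) ?_
    · refine sum_sum_le_of_forall_four hcomm (linkMultiplicity_self hG S)
        (fun x y => hS ▸ linkMultiplicity_le_card G S x y) _ fun T hT hcard => ?_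
      exact sum_sum_linkMultiplicity_le hG hfano hS hclique hcard
        (disjoint_of_subset_right hT disjoint_sdiff)
    · exact (sum_le_card_nsmul _ _ _ fun x _ => hcross x).trans_eq (by rw [smul_eq_mul]; ring)
  rw [sum_sum_linkMultiplicity hG, card_univ] at hbound
  have hne : S.Nonempty := card_pos.1 (by omega)
  obtain ⟨v, -, hv⟩ := exists_le_of_sum_le (f := fun v => 8 * #(G.memberSubfamily v))
    (g := fun _ => 3 * Fintype.card V ^ 2) hne
    (by rw [← mul_sum, sum_const, hS, smul_eq_mul]; omega)
  exact ⟨v, hv⟩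

end Fano

section FanoDensity

variable [Fintype V]

/-- Deleting `v` costs `2 * ∑ E ∈ L, codegree G E` up to lower-order terms, where `L` is the link of
`v`; with `N = card V`, this is absorbed through `2 * N * d ≤ N ^ 2 + d ^ 2`. -/
lemma card_mul_co2_three_le (hG : (G : Set (Finset V)).Sized 3) (v : V) :
    Fintype.card V * co2 3 G ≤ Fintype.card V * co2 3 (G.nonMemberSubfamily v) +
      2 * #(G.memberSubfamily v) ^ 2 + 2 * Fintype.card V ^ 2 * #(G.memberSubfamily v) +
        co2 3 G := by
  have hlink := sized_memberSubfamily hG v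
  have hdel := co2_add_card_memberSubfamily hG v
  have hdegree := card_mul_co2_two_le hlink
  have hsq : ∑ E ∈ G.memberSubfamily v, codegree G E ^ 2 ≤ co2 3 G :=
    sum_le_sum_of_subset fun E hE => mem_powersetCard.2 ⟨subset_univ E, hlink hE⟩
  have hcross : Fintype.card V * (2 * ∑ E ∈ G.memberSubfamily v, codegree G E) ≤
      Fintype.card V ^ 2 * #(G.memberSubfamily v) + co2 3 G :=
    calc Fintype.card V * (2 * ∑ E ∈ G.memberSubfamily v, codegree G E)
        = ∑ E ∈ G.memberSubfamily v, 2 * Fintype.card V * codegree G E := by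
          rw [← mul_sum]; ring
      _ ≤ ∑ E ∈ G.memberSubfamily v, (Fintype.card V ^ 2 + codegree G E ^ 2) :=
          sum_le_sum fun E _ => two_mul_le_add_sq _ _
      _ ≤ Fintype.card V ^ 2 * #(G.memberSubfamily v) + co2 3 G := by
          rw [sum_add_distrib, sum_const, smul_eq_mul, mul_comm]
          gcongr
  have := congrArg (Fintype.card V * ·) hdel
  simp only [mul_add] at this
  linarith [Nat.zero_le (Fintype.card V * #(G.memberSubfamily v))]

lemma three_mul_co2_three_le (hG : (G : Set (Finset V)).Sized 3)
    (hfree : ∀ S, #S = 4 → ¬ powersetCard 3 S ⊆ G) : 3 * co2 3 G ≤ Fintype.card V ^ 4 := by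
  have hcard : 6 * #G ≤ Fintype.card V ^ 3 :=
    calc 6 * #G ≤ (3).factorial * (Fintype.card V).choose 3 := Nat.mul_le_mul_left 6 hG.card_le
      _ = (Fintype.card V).descFactorial 3 := (Nat.descFactorial_eq_factorial_mul_choose _ 3).symm
      _ ≤ Fintype.card V ^ 3 := Nat.descFactorial_le_pow _ 3
  have hco2 := co2_le_of_forall_not_powersetCard_subset hG two_ne_zero hfree
  calc 3 * co2 3 G ≤ 3 * (#G * (2 * Fintype.card V)) := Nat.mul_le_mul_left 3 hco2
    _ = 6 * #G * Fintype.card V := by ring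
    _ ≤ Fintype.card V ^ 3 * Fintype.card V := by gcongr
    _ = Fintype.card V ^ 4 := by ring

lemma sub_one_mul_co2_le_of_clique (hG : (G : Set (Finset V)).Sized 3)
    (hfano : ¬ Contains G fano) {S : Finset V} (hS : #S = 4) (hclique : powersetCard 3 S ⊆ G) :
    32 * ((Fintype.card V - 1) * co2 3 G) ≤
      32 * (Fintype.card V * exco2 3 (Fintype.card V - 1) fano) + 33 * Fintype.card V ^ 4 := by
  obtain ⟨v, hv⟩ := exists_card_memberSubfamily_le hG hfano hS hclique
  have hloss := card_mul_co2_three_le hG v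
  have hdel := Nat.mul_le_mul_left (Fintype.card V) (co2_nonMemberSubfamily_le_exco2 hG hfano v)
  have hsq := Nat.mul_le_mul hv hv
  have hmul := Nat.mul_le_mul_left (Fintype.card V ^ 2) hv
  rw [Nat.sub_one_mul]
  have : 32 * (Fintype.card V * co2 3 G) ≤
      32 * (Fintype.card V * exco2 3 (Fintype.card V - 1) fano) + 33 * Fintype.card V ^ 4 +
        32 * co2 3 G := by
    linarith
  omega

lemma exco2_fano_le (n : ℕ) : 32 * exco2 3 n fano ≤ 11 * n ^ 4 + 64 * n ^ 3 := by
  induction n with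
  | zero =>
    refine mul_exco2_le fun G hG _ => ?_
    have := three_mul_co2_three_le hG fun S hS => by simp [Subsingleton.elim S ∅] at hS
    simpa using this
  | succ n ih =>
    refine mul_exco2_le fun G hG hfano => ?_
    by_cases hfree : ∀ S, #S = 4 → ¬ powersetCard 3 S ⊆ G
    · have := three_mul_co2_three_le hG hfree
      rw [Fintype.card_fin] at this
      omega
    push Not at hfree
    obtain ⟨S, hS, hclique⟩ := hfree
    have hrec := sub_one_mul_co2_le_of_clique hG hfano hS hclique
    have hn : 3 ≤ n := by
      have := S.card_le_univ
      rw [hS, Fintype.card_fin] at this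
      omega
    rw [Fintype.card_fin, Nat.add_sub_cancel] at hrec
    refine Nat.le_of_mul_le_mul_left (c := n) ?_ (by omega)
    have := Nat.mul_le_mul_left (n + 1) ih
    nlinarith

lemma sigma_fano_le : sigma 3 fano ≤ 11 / 16 := by
  have hlim : Filter.Tendsto (fun n : ℕ => (11 / 16 + 4 * (n : ℝ)⁻¹) /
      ((1 - (n : ℝ)⁻¹) * (1 - 2 * (n : ℝ)⁻¹) ^ 2)) Filter.atTop (nhds (11 / 16)) := by
    have hinv : Filter.Tendsto (fun n : ℕ => (n : ℝ)⁻¹) Filter.atTop (nhds 0) :=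
      tendsto_inv_atTop_nhds_zero_nat
    have := ((hinv.const_mul 4).const_add (11 / 16)).div
      ((hinv.const_sub 1).mul (((hinv.const_mul 2).const_sub 1).pow 2)) (by norm_num)
    simpa [Pi.div_def] using this
  refine le_of_tendsto_of_tendsto (tendsto_scaledExco2 2 fano) hlim ?_
  filter_upwards [Filter.eventually_ge_atTop 3] with n hn
  have hn' : (3 : ℝ) ≤ n := by exact_mod_cast hn
  have : (0 : ℝ) < n := by linarith
  have hn₁ : (0 : ℝ) < n - 1 := by linarith
  have hn₂ : (0 : ℝ) < n - 2 := by linarith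
  have hexco2 : (exco2 3 n fano : ℝ) ≤ 11 / 32 * n ^ 4 + 2 * n ^ 3 := by
    have : (32 * exco2 3 n fano : ℝ) ≤ 11 * n ^ 4 + 64 * n ^ 3 := by
      exact_mod_cast exco2_fano_le n
    linarith
  calc scaledExco2 3 fano n
      = exco2 3 n fano / (n * (n - 1) / 2 * (n - 2) ^ 2) := by
        rw [scaledExco2, Nat.cast_choose_two]
        congr 3
        push_cast
        ring
    _ ≤ (11 / 32 * n ^ 4 + 2 * n ^ 3) / (n * (n - 1) / 2 * (n - 2) ^ 2) := by gcongr
    _ = _ := by field_simp; ring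

end FanoDensity

end CodegreeSquared

theorem mainTheorem9 :
    Filter.Tendsto (CodegreeSquared.scaledExco2 3 CodegreeSquared.fano) Filter.atTop
        (nhds (CodegreeSquared.sigma 3 CodegreeSquared.fano)) ∧
      CodegreeSquared.sigma 3 CodegreeSquared.fano ≤ 11 / 16 :=
  ⟨CodegreeSquared.tendsto_scaledExco2 2 CodegreeSquared.fano, CodegreeSquared.sigma_fano_le⟩
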